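/- For a scheme $S$ and an $S$-scheme $Z$ let $T_{Z/S} := \underline{\mathrm{Spec}}_Z\,\mathrm{Sym}(\Omega^1_{Z/S})$, regarded as an $S$-scheme; this defines a functor $T_{- /S}\colon \mathbf{Sch}_{/S}\to\mathbf{Sch}_{/S}$. For a morphism $f\colon X\to Y$ let $f^*\colon \mathbf{Sch}_{/Y}\to\mathbf{Sch}_{/X}$, $f^*Z = Z\times_Y X$, and let $$({}_fT^{-1})_Z\colon T_{f^*Z/X}\longrightarrow f^*T_{Z/Y} = T_{Z/Y}\times_Y X$$ be the canonical morphism over $X$ whose first component is the map $T_{f^*Z/X}\to T_{Z/Y}$ induced by the projection $f^*Z\to Z$ over $f$. (For $X=\mathrm{Spec}\,A$, $Y=\mathrm{Spec}\,C$, $Z=\mathrm{Spec}\,B$ it is the spectrum of the ring map $\mathrm{Sym}(\Omega^1_{B/C})\otimes_C A\to \mathrm{Sym}(\Omega^1_{B\otimes_C A/A})$ given by $b\otimes a\mapsto b\otimes a$ and $\mathrm{d}b\otimes a\mapsto \mathrm{d}(b\otimes a)$.) Let $\mathbf{Sch}_{/ -}\colon \mathbf{Sch}^{\mathrm{op}}\to\mathfrak{Cat}$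 be the pseudofunctor $X\mapsto\mathbf{Sch}_{/X}$, $f\mapsto f^*$, whose compositors, for $X\xrightarrow{f}Y\xrightarrow{g}Z$, are the cancellation isomorphisms $\phi_{f,g}^W\colon f^*g^*W=(W\times_Z Y)\times_Y X\cong W\times_Z X=(g\circ f)^*W$ and whose unitors are the isomorphisms $W\times_X X\cong W$. **Proposition.** For every morphism $f\colon X\to Y$ of schemes the morphisms $({}_fT^{-1})_Z$ are isomorphisms, natural in $Z$; they are the inverse of a natural isomorphism ${}_fT\colon f^*\circ T_{- /Y}\Rightarrow T_{- /X}\circ f^*$. For every composable pair $X\xrightarrow{f}Y\xrightarrow{g}Z$ of morphisms of schemes, $$(\phi_{f,g} * T_{- /Z})\circ(f^* * {}_gT^{-1})\circ({}_fT^{-1} * g^*) \;=\; {}_{g\circ f}T^{-1}\circ(T_{- /X} * \phi_{f,g})$$ as natural transformations $T_{- /X}\circ f^*\circ g^*\Rightarrow (g\circ f)^*\circ T_{- /Z}$. Consequently the functors $T_{- /X}$, for all schemes $X$, together with the natural isomorphisms ${}_fT^{-1}$, for all morphisms $f$, are the components of a pseudonatural transformation $T\colon \mathbf{Sch}_{/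 -}\Rightarrow\mathbf{Sch}_{/ -}$. -/

import Mathlib

universe u

open CategoryTheory Limits AlgebraicGeometry Opposite

noncomputable section

namespace RelTangent

section Algebra

/-- The ring `Sym_B(Ω¹_{B/A})` attached to a ring map `φ : A ⟶ B`. -/
def symAlg {A B : CommRingCat.{u}} (φ : A ⟶ B) : CommRingCat.{u} :=
  .of (SymmetricAlgebra B (CommRingCat.KaehlerDifferential φ))

/-- The structure map `B ⟶ Sym_B(Ω¹_{B/A})`. -/
def symIncl {A B : CommRingCat.{u}} (φ : A ⟶ B) : B ⟶ symAlg φ :=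
  CommRingCat.ofHom (algebraMap B (SymmetricAlgebra B (CommRingCat.KaehlerDifferential φ)))

/-- The element `db` of `Sym_B(Ω¹_{B/A})`. -/
def symD {A B : CommRingCat.{u}} (φ : A ⟶ B) (b : B) : symAlg φ :=
  SymmetricAlgebra.ι B (CommRingCat.KaehlerDifferential φ) (CommRingCat.KaehlerDifferential.d b)

variable {A B : CommRingCat.{u}} (φ : A ⟶ B)

lemma symD_add (b b' : B) : symD φ (b + b') = symD φ b + symD φ b' := by
  simp [symD]; rfl

lemma symD_mul (b b' : B) :
    symD φ (b * b') = symIncl φ b * symD φ b' + symIncl φ b' * symD φ b := by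
  simp only [symD, ModuleCat.Derivation.d_mul, map_add, map_smul, Algebra.smul_def]; rfl

lemma symD_map (a : A) : symD φ (φ a) = 0 := by
  simp [symD]; rfl

variable {φ} in
lemma symAlg_hom_ext {R : CommRingCat.{u}} {p q : symAlg φ ⟶ R}
    (h₁ : symIncl φ ≫ p = symIncl φ ≫ q) (h₂ : ∀ b, p (symD φ b) = q (symD φ b)) : p = q := by
  let : Algebra B R := (symIncl φ ≫ p).hom.toAlgebra
  let p' : SymmetricAlgebra B (CommRingCat.KaehlerDifferential φ) →ₐ[B] R :=
    { p.hom with commutes' := fun b ↦ rfl }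
  let q' : SymmetricAlgebra B (CommRingCat.KaehlerDifferential φ) →ₐ[B] R :=
    { q.hom with commutes' := fun b ↦ (ConcreteCategory.congr_hom h₁ b).symm }
  have hpq : p' = q' := by
    apply SymmetricAlgebra.algHom_ext
    have : (ModuleCat.ofHom (X := CommRingCat.KaehlerDifferential φ) (Y := ModuleCat.of B R)
        (p'.toLinearMap ∘ₗ SymmetricAlgebra.ι B _)) = ModuleCat.ofHom
        (q'.toLinearMap ∘ₗ SymmetricAlgebra.ι B _) := by
      apply CommRingCat.KaehlerDifferential.ext
      exact h₂
    exact congrArg ModuleCat.Hom.hom this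
  ext x
  exact congr($hpq x)

/-- The ring map out of `Sym_B(Ω¹_{B/A})` determined by a ring map `p : B ⟶ R` and an `A`-linear
derivation `δ : B → R` along `p`. -/
def symDesc {R : CommRingCat.{u}} (p : B ⟶ R) (δ : B → R)
    (hadd : ∀ b b', δ (b + b') = δ b + δ b')
    (hmul : ∀ b b', δ (b * b') = p b * δ b' + p b' * δ b)
    (hmap : ∀ a, δ (φ a) = 0) : symAlg φ ⟶ R :=
  letI : Algebra B R := p.hom.toAlgebra
  CommRingCat.ofHom (SymmetricAlgebra.lift (M := CommRingCat.KaehlerDifferential φ) (R := B)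
    (A := R) (ModuleCat.Derivation.desc (M := ModuleCat.of B R)
      (ModuleCat.Derivation.mk δ hadd hmul hmap)).hom).toRingHom

section
variable {R : CommRingCat.{u}} (p : B ⟶ R) (δ : B → R)
    (hadd : ∀ b b', δ (b + b') = δ b + δ b')
    (hmul : ∀ b b', δ (b * b') = p b * δ b' + p b' * δ b)
    (hmap : ∀ a, δ (φ a) = 0)

lemma symIncl_desc : symIncl φ ≫ symDesc φ p δ hadd hmul hmap = p := by
  let : Algebra B R := p.hom.toAlgebra
  ext b
  exact AlgHom.commutes (SymmetricAlgebra.lift (M := CommRingCat.KaehlerDifferential φ) (R := B)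
    (A := R) (ModuleCat.Derivation.desc (M := ModuleCat.of B R)
      (ModuleCat.Derivation.mk δ hadd hmul hmap)).hom) b

lemma symDesc_d (b : B) : symDesc φ p δ hadd hmul hmap (symD φ b) = δ b := by
  let : Algebra B R := p.hom.toAlgebra
  refine (SymmetricAlgebra.lift_ι_apply (M := CommRingCat.KaehlerDifferential φ) (R := B)
    (A := R) (ModuleCat.Derivation.desc (M := ModuleCat.of B R)
      (ModuleCat.Derivation.mk δ hadd hmul hmap)).hom _).trans ?_
  exact ModuleCat.Derivation.desc_d (M := ModuleCat.of B R)
    (ModuleCat.Derivation.mk δ hadd hmul hmap) b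
end

section
variable {φ} {B' : CommRingCat.{u}}

lemma eq_zero_of_formallyUnramified {α : A ⟶ B} (hα : α.hom.FormallyUnramified)
    {R : CommRingCat.{u}} (p : B ⟶ R) (δ : B → R)
    (hadd : ∀ b b', δ (b + b') = δ b + δ b')
    (hmul : ∀ b b', δ (b * b') = p b * δ b' + p b' * δ b)
    (hmap : ∀ a, δ (α a) = 0) (b : B) : δ b = 0 := by
  have : (CommRingCat.KaehlerDifferential.d b : CommRingCat.KaehlerDifferential α) = 0 := by
    algebraize [α.hom]
    exact (Algebra.FormallyUnramified.subsingleton_kaehlerDifferential (R := A) (A := B)).elim _ _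
  rw [← symDesc_d α p δ hadd hmul hmap, symD, this, map_zero]
  exact map_zero (symDesc α p δ hadd hmul hmap).hom

lemma exists_extension_of_formallyEtale {β : B ⟶ B'} (hβ : β.hom.FormallyEtale)
    {R : CommRingCat.{u}} (p : B' ⟶ R) (δ : B → R)
    (hadd : ∀ b b', δ (b + b') = δ b + δ b')
    (hmul : ∀ b b', δ (b * b') = p (β b) * δ b' + p (β b') * δ b)
    (hmap : ∀ a, δ (φ a) = 0) :
    ∃ δ' : B' → R, (∀ b b', δ' (b + b') = δ' b + δ' b') ∧
      (∀ b b', δ' (b * b') = p b * δ' b' + p b' * δ' b) ∧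
      (∀ a, δ' (β (φ a)) = 0) ∧ ∀ b, δ' (β b) = δ b := by
  algebraize [φ.hom, β.hom, p.hom, β.hom.comp φ.hom, p.hom.comp β.hom,
    (p.hom.comp β.hom).comp φ.hom]
  have : IsScalarTower A B R := .of_algebraMap_eq' rfl
  have : IsScalarTower A B' R := .of_algebraMap_eq' rfl
  let δ₀ : Derivation A B R :=
    { toFun := δ
      map_add' := hadd
      map_smul' := fun a b ↦ by
        rw [Algebra.smul_def, Algebra.smul_def]
        refine (hmul _ _).trans ?_
        erw [hmap]
        rw [mul_zero, add_zero]; rfl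
      map_one_eq_zero' := by
        have := hmap 1
        simpa using this
      leibniz' := fun a b ↦ by
        simp only [Algebra.smul_def]
        exact hmul a b }
  let L : TensorProduct B B' (Ω[B⁄A]) →ₗ[B'] R :=
    LinearMap.liftBaseChange B' δ₀.liftKaehlerDifferential
  let L' : Ω[B'⁄A] →ₗ[B'] R :=
    L ∘ₗ (KaehlerDifferential.tensorKaehlerEquivOfFormallyEtale A B B').symm.toLinearMap
  let δ' : Derivation A B' R := L'.compDer (KaehlerDifferential.D A B')
  refine ⟨δ', map_add δ', fun b b' ↦ ?_, fun a ↦ δ'.map_algebraMap a, fun b ↦ ?_⟩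
  · exact (δ'.leibniz b b').trans (by simp only [Algebra.smul_def]; rfl)
  · change L ((KaehlerDifferential.tensorKaehlerEquivOfFormallyEtale A B B').symm
      (KaehlerDifferential.D A B' (algebraMap B B' b))) = _
    rw [KaehlerDifferential.tensorKaehlerEquivOfFormallyEtale_symm_D_algebraMap]
    simp [L]
    rfl

end

variable {φ}

/-- A commutative square of rings induces the ring map `b ↦ β b`, `db ↦ d(β b)`. -/
def symMap {A' B' : CommRingCat.{u}} {φ' : A' ⟶ B'} (α : A ⟶ A') (β : B ⟶ B')
    (h : φ ≫ β = α ≫ φ') : symAlg φ ⟶ symAlg φ' :=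
  symDesc φ (β ≫ symIncl φ') (fun b ↦ symD φ' (β b)) (by simp [symD_add]) (by simp [symD_mul])
    (fun a ↦ by
      have : β (φ a) = φ' (α a) := ConcreteCategory.congr_hom h a
      rw [this, symD_map])

section
variable {A' B' : CommRingCat.{u}} {φ' : A' ⟶ B'} (α : A ⟶ A') (β : B ⟶ B')
    (h : φ ≫ β = α ≫ φ')

@[simp]
lemma symIncl_map : symIncl φ ≫ symMap α β h = β ≫ symIncl φ' := symIncl_desc ..

@[simp]
lemma symIncl_map_assoc {R : CommRingCat.{u}} (q : symAlg φ' ⟶ R) :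
    symIncl φ ≫ symMap α β h ≫ q = β ≫ symIncl φ' ≫ q := by
  rw [← Category.assoc, symIncl_map, Category.assoc]

@[simp]
lemma symMap_d (b : B) : symMap α β h (symD φ b) = symD φ' (β b) := symDesc_d ..

lemma symMap_id (h) : symMap (φ := φ) (φ' := φ) (𝟙 _) (𝟙 _) h = 𝟙 _ :=
  symAlg_hom_ext (by simp) (by simp)

lemma symMap_comp {A'' B'' : CommRingCat.{u}} {φ'' : A'' ⟶ B''} (α' : A' ⟶ A'') (β' : B' ⟶ B'')
    (h' : φ' ≫ β' = α' ≫ φ'') (h'') :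
    symMap (φ := φ) (φ' := φ'') (α ≫ α') (β ≫ β') h'' = symMap α β h ≫ symMap α' β' h' :=
  symAlg_hom_ext (by simp) (by simp)

/-- `Sym(Ω¹)` is compatible with localisation: if `A ⟶ A'` is formally unramified and `B ⟶ B'` is
formally étale, then `Sym_{B'}(Ω¹_{B'/A'}) = B' ⊗_B Sym_B(Ω¹_{B/A})`. -/
lemma isPushout_symMap (hα : α.hom.FormallyUnramified) (hβ : β.hom.FormallyEtale) :
    IsPushout β (symIncl φ) (symIncl φ') (symMap α β h) := by
  refine ⟨⟨by simp⟩, ⟨PushoutCocone.isColimitAux' _ fun s ↦ ?_⟩⟩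
  have hs (b : B) : s.inr (symIncl φ b) = s.inl (β b) :=
    (ConcreteCategory.congr_hom s.condition b).symm
  have ex := exists_extension_of_formallyEtale (φ := φ) hβ s.inl (fun b ↦ s.inr (symD φ b))
    (by simp [symD_add]) (by simp [symD_mul, hs]) (by simp [symD_map])
  let δ := ex.choose
  obtain ⟨hadd, hmul, hmap, hd⟩ : _ ∧ _ ∧ _ ∧ _ := ex.choose_spec
  have hA (a : A) : φ' (α a) = β (φ a) := (ConcreteCategory.congr_hom h a).symm
  have hmap' : ∀ a, δ (φ' a) = 0 :=
    eq_zero_of_formallyUnramified hα (φ' ≫ s.inl) (fun a ↦ δ (φ' a))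
      (by simp [δ, hadd]) (by simp [δ, hmul]) (fun a ↦ by rw [hA]; exact hmap a)
  refine ⟨symDesc φ' s.inl δ hadd hmul hmap', symIncl_desc .., ?_, ?_⟩
  · refine symAlg_hom_ext ?_ fun b ↦ ?_
    · change symIncl φ ≫ symMap α β h ≫ _ = _
      rw [← Category.assoc, symIncl_map, Category.assoc, symIncl_desc]
      exact s.condition
    · change symDesc φ' s.inl δ hadd hmul hmap' (symMap α β h (symD φ b)) = _
      rw [symMap_d, symDesc_d]
      exact hd b
  · suffices H : ∀ m : symAlg φ' ⟶ s.pt, symIncl φ' ≫ m = s.inl → symMap α β h ≫ m = s.inr →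
        m = symDesc φ' s.inl δ hadd hmul hmap' from fun {m} hm₁ hm₂ ↦ H m hm₁ hm₂
    intro m hm₁ hm₂
    have hm₃ (b : B') : m (symIncl φ' b) = s.inl b := ConcreteCategory.congr_hom hm₁ b
    refine symAlg_hom_ext (hm₁.trans (symIncl_desc ..).symm) fun b ↦ ?_
    rw [symDesc_d, ← sub_eq_zero]
    refine eq_zero_of_formallyUnramified (α := β) (by algebraize [β.hom]; exact ⟨inferInstance⟩)
      s.inl (fun b ↦ m (symD φ' b) - δ b) ?_ ?_ ?_ b
    · intro b b'
      simp only [symD_add, map_add, δ, hadd]; ring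
    · intro b b'
      simp only [symD_mul, map_add, map_mul, δ, hmul, hm₃]; ring
    · intro b
      have h₁ : m (symD φ' (β b)) = s.inr (symD φ b) := by
        rw [← symMap_d α β h, ← hm₂]; rfl
      simp only [h₁, δ, hd, sub_self]
end

end Algebra

variable {X S : Scheme.{u}}

lemma appLE_id (U : X.Opens) (h : U ≤ 𝟙 X ⁻¹ᵁ U) : (𝟙 X : X ⟶ X).appLE U U h = 𝟙 _ := by
  simp only [Scheme.Hom.appLE, Scheme.Hom.id_app]
  exact (Category.id_comp _).trans (X.presheaf.map_id _)

/-- A chart of a morphism `f : X ⟶ S`: an affine open `U` of `X` and an affine open `V` of `S`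
with `f(U) ⊆ V`. -/
structure Chart (f : X ⟶ S) where
  U : X.Opens
  V : S.Opens
  hU : IsAffineOpen U
  hV : IsAffineOpen V
  le : U ≤ f ⁻¹ᵁ V

namespace Chart

instance (f : X ⟶ S) : Preorder (Chart f) where
  le c c' := c.U ≤ c'.U ∧ c.V ≤ c'.V
  le_refl _ := ⟨le_rfl, le_rfl⟩
  le_trans _ _ _ h h' := ⟨h.1.trans h'.1, h.2.trans h'.2⟩

lemma leU {f : X ⟶ S} {c c' : Chart f} (h : c ≤ c') : c.U ≤ 𝟙 X ⁻¹ᵁ c'.U := h.1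

lemma leV {f : X ⟶ S} {c c' : Chart f} (h : c ≤ c') : c.V ≤ 𝟙 S ⁻¹ᵁ c'.V := h.2

/-- The ring map `Γ(S, V) ⟶ Γ(X, U)` of a chart. -/
abbrev ring {f : X ⟶ S} (c : Chart f) : Γ(S, c.V) ⟶ Γ(X, c.U) := f.appLE c.V c.U c.le

/-- The tangent scheme `Spec (Sym (Ω¹_{Γ(X, U)/Γ(S, V)}))` of a chart. -/
abbrev tangent {f : X ⟶ S} (c : Chart f) : Scheme.{u} := Spec (symAlg c.ring)

lemma exists_mem (f : X ⟶ S) (x : X) (W : X.Opens) (hxW : x ∈ W) (W' : S.Opens)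
    (hxW' : f x ∈ W') : ∃ c : Chart f, x ∈ c.U ∧ c.U ≤ W ∧ c.V ≤ W' := by
  obtain ⟨_, ⟨V, hV, rfl⟩, hxV, hVW⟩ :=
    S.isBasis_affineOpens.exists_subset_of_mem_open hxW' W'.2
  obtain ⟨_, ⟨U, hU, rfl⟩, hxU, hUW⟩ :=
    X.isBasis_affineOpens.exists_subset_of_mem_open
      (show x ∈ W ⊓ f ⁻¹ᵁ V from ⟨hxW, hxV⟩) (W ⊓ f ⁻¹ᵁ V).2
  exact ⟨⟨U, V, hU, hV, fun y hy ↦ (hUW hy).2⟩, hxU, fun y hy ↦ (hUW hy).1, hVW⟩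

section map

variable {X' S' : Scheme.{u}} {f' : X' ⟶ S'} {f : X ⟶ S}

/-- For a commutative square `(g, s) : f' ⟶ f`, charts `c'` of `f'` and `c` of `f` with
`g(U') ⊆ U` and `s(V') ⊆ V`, the map
`Spec (Sym (Ω¹_{Γ(X', U')/Γ(S', V')})) ⟶ Spec (Sym (Ω¹_{Γ(X, U)/Γ(S, V)}))`
given by `b ↦ g^♯ b`, `db ↦ d(g^♯ b)`. -/
def map (g : X' ⟶ X) (s : S' ⟶ S) (sq : f' ≫ s = g ≫ f) (c' : Chart f') (c : Chart f)
    (hU : c'.U ≤ g ⁻¹ᵁ c.U) (hV : c'.V ≤ s ⁻¹ᵁ c.V) : c'.tangent ⟶ c.tangent :=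
  Spec.map (symMap (s.appLE c.V c'.V hV) (g.appLE c.U c'.U hU)
    (by simp only [ring, Scheme.Hom.appLE_comp_appLE, sq]))

/-- The projection `Spec (Sym (Ω¹_{Γ(X, U)/Γ(S, V)})) ⟶ Spec Γ(X, U)`. -/
abbrev proj (c : Chart f) : c.tangent ⟶ Spec Γ(X, c.U) := Spec.map (symIncl c.ring)

lemma map_proj (g : X' ⟶ X) (s : S' ⟶ S) (sq : f' ≫ s = g ≫ f) (c' : Chart f') (c : Chart f)
    (hU : c'.U ≤ g ⁻¹ᵁ c.U) (hV : c'.V ≤ s ⁻¹ᵁ c.V) :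
    map g s sq c' c hU hV ≫ c.proj = c'.proj ≫ Spec.map (g.appLE c.U c'.U hU) := by
  simp only [map, proj, ← Spec.map_comp, symIncl_map]

lemma map_id (c : Chart f) (sq hU hV) : map (𝟙 X) (𝟙 S) sq c c hU hV = 𝟙 c.tangent := by
  simp only [map]
  rw [← Spec.map_id]
  congr 1
  refine symAlg_hom_ext ?_ ?_ <;> simp [appLE_id]

lemma map_comp {X'' S'' : Scheme.{u}} {f'' : X'' ⟶ S''} (g' : X'' ⟶ X') (s' : S'' ⟶ S') (sq')
    (g : X' ⟶ X) (s : S' ⟶ S) (sq) (c'' : Chart f'') (c' : Chart f') (c : Chart f)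
    (hU' hV' hU hV) {h : X'' ⟶ X} {t : S'' ⟶ S} (hh : h = g' ≫ g) (ht : t = s' ≫ s)
    (sq'') (hU'') (hV'') :
    map g' s' sq' c'' c' hU' hV' ≫ map g s sq c' c hU hV = map h t sq'' c'' c hU'' hV'' := by
  subst hh ht
  simp only [map, ← Spec.map_comp]
  congr 1
  refine symAlg_hom_ext ?_ ?_
  · simp [Scheme.Hom.appLE_comp_appLE_assoc]
  · intro b
    simp [← Scheme.Hom.appLE_comp_appLE _ _ c.U c'.U c''.U hU hU']

lemma map_comp_assoc {X'' S'' : Scheme.{u}} {f'' : X'' ⟶ S''} (g' : X'' ⟶ X') (s' : S'' ⟶ S')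
    (sq') (g : X' ⟶ X) (s : S' ⟶ S) (sq) (c'' : Chart f'') (c' : Chart f') (c : Chart f)
    (hU' hV' hU hV) {h : X'' ⟶ X} {t : S'' ⟶ S} (hh : h = g' ≫ g) (ht : t = s' ≫ s)
    (sq'') (hU'') (hV'') {Z : Scheme.{u}} (q : c.tangent ⟶ Z) :
    map g' s' sq' c'' c' hU' hV' ≫ map g s sq c' c hU hV ≫ q =
      map h t sq'' c'' c hU'' hV'' ≫ q := by
  rw [← Category.assoc, map_comp g' s' sq' g s sq c'' c' c hU' hV' hU hV hh ht sq'' hU'' hV'']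

end map

/-- The charts of `f : X ⟶ S` cover `X`. -/
abbrev cover (f : X ⟶ S) : X.OpenCover where
  I₀ := Chart f
  X c := Spec Γ(X, c.U)
  f c := c.hU.fromSpec
  mem₀ := by
    rw [Scheme.presieve₀_mem_precoverage_iff]
    refine ⟨fun x ↦ ?_, fun c ↦ c.hU.isOpenImmersion_fromSpec⟩
    obtain ⟨c, hc, -, -⟩ := exists_mem f x ⊤ trivial ⊤ trivial
    refine ⟨c, ?_⟩
    rw [c.hU.range_fromSpec]
    exact hc

instance (f : X ⟶ S) : Small.{u} (Chart f) := by
  let i : Chart f → X.Opens × S.Opens := fun c ↦ (c.U, c.V)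
  have : Function.Injective i := by
    rintro ⟨U, V, _, _, _⟩ ⟨U', V', _, _, _⟩ h
    obtain ⟨rfl, rfl⟩ := Prod.mk.inj h
    rfl
  exact small_of_injective this

/-- The transition map `Spec Γ(X, U) ⟶ Spec Γ(X, U')` for `U ⊆ U'`. -/
def trans {f : X ⟶ S} {c c' : Chart f} (h : c ≤ c') : Spec Γ(X, c.U) ⟶ Spec Γ(X, c'.U) :=
  Spec.map ((𝟙 X : X ⟶ X).appLE c'.U c.U (leU h))

lemma trans_fromSpec {f : X ⟶ S} {c c' : Chart f} (h : c ≤ c') :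
    trans h ≫ c'.hU.fromSpec = c.hU.fromSpec := by
  exact (IsAffineOpen.SpecMap_appLE_fromSpec (𝟙 X) c'.hU c.hU (leU h)).trans (Category.comp_id _)

instance {f : X ⟶ S} {c c' : Chart f} (h : c ≤ c') : IsOpenImmersion (trans h) := by
  have : IsOpenImmersion (trans h ≫ c'.hU.fromSpec) := by
    rw [trans_fromSpec]; exact c.hU.isOpenImmersion_fromSpec
  exact IsOpenImmersion.of_comp _ c'.hU.fromSpec

instance (f : X ⟶ S) : (cover f).LocallyDirected where
  trans {c c'} h := trans (f := f) (c := c) (c' := c') (leOfHom h)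
  trans_id c := by rw [trans, appLE_id, Spec.map_id]
  trans_comp {c c' c''} h h' := by
    simp only [trans, ← Spec.map_comp]
    rw [Scheme.Hom.appLE_comp_appLE]
    congr 1
  w {c c'} h := trans_fromSpec _
  directed {c c'} x := by
    dsimp at x ⊢
    let a : X := (pullback.fst c.hU.fromSpec c'.hU.fromSpec ≫ c.hU.fromSpec) x
    have haU : a ∈ c.U := by
      rw [← SetLike.mem_coe, ← c.hU.range_fromSpec]
      exact ⟨pullback.fst c.hU.fromSpec c'.hU.fromSpec x, by simp [a]⟩
    have haU' : a ∈ c'.U := by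
      rw [← SetLike.mem_coe, ← c'.hU.range_fromSpec]
      exact ⟨pullback.snd c.hU.fromSpec c'.hU.fromSpec x, by
        simp only [a]; rw [pullback.condition]; simp⟩
    obtain ⟨k, hak, hkU, hkV⟩ := exists_mem f a (c.U ⊓ c'.U) ⟨haU, haU'⟩ (c.V ⊓ c'.V)
      ⟨c.le haU, c'.le haU'⟩
    have hk : k ≤ c := ⟨hkU.trans inf_le_left, hkV.trans inf_le_left⟩
    have hk' : k ≤ c' := ⟨hkU.trans inf_le_right, hkV.trans inf_le_right⟩
    rw [← SetLike.mem_coe, ← k.hU.range_fromSpec] at hak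
    obtain ⟨y, hy⟩ := hak
    refine ⟨k, homOfLE hk, homOfLE hk', y, ?_⟩
    apply (pullback.fst c.hU.fromSpec c'.hU.fromSpec ≫ c.hU.fromSpec).isOpenEmbedding.injective
    rw [← Scheme.Hom.comp_apply, pullback.lift_fst_assoc, trans_fromSpec]
    exact hy
  property_trans {c c'} h := inferInstanceAs (IsOpenImmersion (trans (leOfHom h)))

lemma isPullback_map {f : X ⟶ S} {c c' : Chart f} (h : c ≤ c') :
    IsPullback (map (𝟙 X) (𝟙 S) (by simp) c c' (Chart.leU h) (Chart.leV h)) c.proj c'.proj (trans h) := by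
  refine (isPullback_SpecMap_of_isPushout _ _ _ _ (isPushout_symMap _ _ _ ?_ ?_)).flip
  · exact (𝟙 S : S ⟶ S).formallyUnramified_appLE c'.hV c.hV (leV h)
  · have := (𝟙 X : X ⟶ X).etale_appLE c'.hU c.hU (leU h)
    algebraize [((𝟙 X : X ⟶ X).appLE c'.U c.U (leU h)).hom]
    exact this.formallyEtale

end Chart

/-- The gluing datum of the schemes `Spec (Sym (Ω¹_{Γ(X, U)/Γ(S, V)}))`, for all charts of `f`. -/
def gluingData (f : X ⟶ S) : (Chart.cover f).RelativeGluingData where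
  functor :=
    { obj c := Chart.tangent (f := f) c
      map {c c'} h := Chart.map (𝟙 X) (𝟙 S) (by simp) c c' (Chart.leU (leOfHom h)) (Chart.leV (leOfHom h))
      map_id c := Chart.map_id ..
      map_comp h h' := (Chart.map_comp _ _ _ _ _ _ _ _ _ _ _ _ _ (by simp) (by simp) _ _ _).symm }
  natTrans :=
    { app c := Chart.proj c
      naturality c c' h := (Chart.isPullback_map (leOfHom h)).w }
  equifibered c c' h := Chart.isPullback_map (leOfHom h)

instance (f : X ⟶ S) : ((gluingData f).functor ⋙ Scheme.forget).IsLocallyDirected :=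
  Scheme.Cover.RelativeGluingData.instIsLocallyDirectedI₀CompFunctorForgetOfIsThin ..

/-- The relative tangent scheme `T_{X/S} = Spec (Sym (Ω¹_{X/S}))` of `f : X ⟶ S`, glued from the
affine schemes `Spec (Sym (Ω¹_{Γ(X, U)/Γ(S, V)}))`, where `U ⊆ X` and `V ⊆ S` are affine open with
`f(U) ⊆ V`. -/
def tangent (f : X ⟶ S) : Scheme.{u} := (gluingData f).glued

/-- The projection `T_{X/S} ⟶ X`. -/
def tangentProj (f : X ⟶ S) : tangent f ⟶ X := (gluingData f).toBase

/-- The inclusion `Spec (Sym (Ω¹_{Γ(X, U)/Γ(S, V)})) ⟶ T_{X/S}` of a chart. -/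
def tangentι {f : X ⟶ S} (c : Chart f) : c.tangent ⟶ tangent f :=
  colimit.ι (gluingData f).functor c

instance {f : X ⟶ S} (c : Chart f) : IsOpenImmersion (tangentι c) :=
  (gluingData f).cover.map_prop c

lemma tangentι_proj {f : X ⟶ S} (c : Chart f) :
    tangentι c ≫ tangentProj f = c.proj ≫ c.hU.fromSpec :=
  (gluingData f).ι_toBase c

/-- Over `U`, the scheme `T_{X/S}` is `Spec (Sym (Ω¹_{Γ(X, U)/Γ(S, V)}))`. -/
lemma isPullback_tangentι {f : X ⟶ S} (c : Chart f) :
    IsPullback c.proj (tangentι c) c.hU.fromSpec (tangentProj f) :=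
  (gluingData f).isPullback_natTrans_ι_toBase c

lemma map_tangentι {f : X ⟶ S} {c c' : Chart f} (h : c ≤ c') :
    Chart.map (𝟙 X) (𝟙 S) (by simp) c c' (Chart.leU h) (Chart.leV h) ≫ tangentι c' = tangentι c :=
  colimit.w (gluingData f).functor (homOfLE h)

lemma mem_opensRange_tangentι {f : X ⟶ S} (c : Chart f) (t : tangent f) :
    t ∈ (tangentι c).opensRange ↔ tangentProj f t ∈ c.U := by
  have := (gluingData f).toBase_preimage_eq_opensRange_ι c
  rw [show ((Chart.cover f).f c).opensRange = c.U from c.hU.opensRange_fromSpec] at this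
  exact (iff_of_eq congr(t ∈ $this)).symm

section map

variable {X' S' : Scheme.{u}} {f' : X' ⟶ S'} {f : X ⟶ S} (g : X' ⟶ X) (s : S' ⟶ S)
  (sq : f' ≫ s = g ≫ f)

/-- Morphisms out of `T_{X/S}` may be compared on sufficiently many charts. -/
lemma tangent_hom_ext {Z : Scheme.{u}} {p q : tangent f ⟶ Z}
    (h : ∀ x : X, ∃ c : Chart f, x ∈ c.U ∧ tangentι c ≫ p = tangentι c ≫ q) : p = q := by
  refine Scheme.hom_ext_of_forall _ _ fun t ↦ ?_
  obtain ⟨c, hc, hpq⟩ := h (tangentProj f t)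
  refine ⟨(tangentι c).opensRange, (mem_opensRange_tangentι c t).mpr hc, ?_⟩
  rw [← cancel_epi (tangentι c).isoOpensRange.hom]
  simpa using hpq

/-- A pair of compatible charts of the two sides of a commutative square. -/
structure ChartPair where
  src : Chart f'
  tgt : Chart f
  hU : src.U ≤ g ⁻¹ᵁ tgt.U
  hV : src.V ≤ s ⁻¹ᵁ tgt.V

namespace ChartPair

variable {g s}

instance : Preorder (ChartPair (f' := f') (f := f) g s) where
  le c c' := c.src ≤ c'.src ∧ c.tgt ≤ c'.tgt
  le_refl _ := ⟨le_rfl, le_rfl⟩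
  le_trans _ _ _ h h' := ⟨h.1.trans h'.1, h.2.trans h'.2⟩

lemma exists_mem (sq : f' ≫ s = g ≫ f) (x : X') (W : Chart f') (hW : x ∈ W.U) (Z : Chart f) (hZ : g x ∈ Z.U) :
    ∃ c : ChartPair (f' := f') (f := f) g s, x ∈ c.src.U ∧ c.src ≤ W ∧ c.tgt ≤ Z := by
  have hx : s (f' x) ∈ Z.V := by
    rw [← Scheme.Hom.comp_apply, sq, Scheme.Hom.comp_apply]
    exact Z.le hZ
  obtain ⟨c, hxc, hcU, hcV⟩ := Chart.exists_mem f' x (W.U ⊓ g ⁻¹ᵁ Z.U) ⟨hW, hZ⟩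
    (W.V ⊓ s ⁻¹ᵁ Z.V) ⟨W.le hW, hx⟩
  exact ⟨⟨c, Z, hcU.trans inf_le_right, hcV.trans inf_le_right⟩, hxc,
    ⟨hcU.trans inf_le_left, hcV.trans inf_le_left⟩, le_rfl⟩

lemma exists_mem' (sq : f' ≫ s = g ≫ f) (x : X') : ∃ c : ChartPair (f' := f') (f := f) g s, x ∈ c.src.U := by
  obtain ⟨W, hW, -, -⟩ := Chart.exists_mem f' x ⊤ trivial ⊤ trivial
  obtain ⟨Z, hZ, -, -⟩ := Chart.exists_mem f (g x) ⊤ trivial ⊤ trivial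
  obtain ⟨c, hc, -, -⟩ := exists_mem sq x W hW Z hZ
  exact ⟨c, hc⟩

/-- The cover of `T_{X'/S'}` by the sources of all pairs of compatible charts. -/
abbrev cover : (tangent f').OpenCover where
  I₀ := ChartPair (f' := f') (f := f) g s
  X c := c.src.tangent
  f c := tangentι c.src
  mem₀ := by
    rw [Scheme.presieve₀_mem_precoverage_iff]
    refine ⟨fun t ↦ ?_, fun c ↦ inferInstance⟩
    obtain ⟨c, hc⟩ := exists_mem' sq (tangentProj f' t)
    exact ⟨c, (mem_opensRange_tangentι c.src t).mpr hc⟩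

instance : (cover sq).LocallyDirected where
  trans {c c'} h := Chart.map (𝟙 X') (𝟙 S') (by simp) c.src c'.src
    (Chart.leU (leOfHom h).1) (Chart.leV (leOfHom h).1)
  trans_id c := Chart.map_id ..
  trans_comp h h' := (Chart.map_comp _ _ _ _ _ _ _ _ _ _ _ _ _ (by simp) (by simp) _ _ _).symm
  w {c c'} h := map_tangentι (leOfHom h).1
  directed {c c'} t := by
    dsimp at t ⊢
    let a : tangent f' := (pullback.fst (tangentι c.src) (tangentι c'.src) ≫ tangentι c.src) t
    have ha : tangentProj f' a ∈ c.src.U := by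
      rw [← mem_opensRange_tangentι]
      exact ⟨pullback.fst (tangentι c.src) (tangentι c'.src) t, by simp [a]⟩
    have ha' : tangentProj f' a ∈ c'.src.U := by
      rw [← mem_opensRange_tangentι]
      exact ⟨pullback.snd (tangentι c.src) (tangentι c'.src) t, by
        simp only [a]; rw [pullback.condition]; simp⟩
    obtain ⟨W, hW, hWU, hWV⟩ := Chart.exists_mem f' (tangentProj f' a) (c.src.U ⊓ c'.src.U)
      ⟨ha, ha'⟩ (c.src.V ⊓ c'.src.V) ⟨c.src.le ha, c'.src.le ha'⟩
    obtain ⟨Z, hZ, hZU, hZV⟩ := Chart.exists_mem f (g (tangentProj f' a)) (c.tgt.U ⊓ c'.tgt.U)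
      ⟨c.hU ha, c'.hU ha'⟩ (c.tgt.V ⊓ c'.tgt.V) ⟨c.tgt.le (c.hU ha), c'.tgt.le (c'.hU ha')⟩
    obtain ⟨k, hk, hkW, hkZ⟩ := exists_mem sq (tangentProj f' a) W hW Z hZ
    have h : k ≤ c := ⟨hkW.trans ⟨hWU.trans inf_le_left, hWV.trans inf_le_left⟩,
      hkZ.trans ⟨hZU.trans inf_le_left, hZV.trans inf_le_left⟩⟩
    have h' : k ≤ c' := ⟨hkW.trans ⟨hWU.trans inf_le_right, hWV.trans inf_le_right⟩,
      hkZ.trans ⟨hZU.trans inf_le_right, hZV.trans inf_le_right⟩⟩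
    obtain ⟨y, hy⟩ := (mem_opensRange_tangentι k.src a).mpr hk
    refine ⟨k, homOfLE h, homOfLE h', y, ?_⟩
    apply (pullback.fst (tangentι c.src) (tangentι c'.src) ≫
      tangentι c.src).isOpenEmbedding.injective
    rw [← Scheme.Hom.comp_apply, pullback.lift_fst_assoc, map_tangentι h.1]
    exact hy
  property_trans {c c'} h := by
    have : IsOpenImmersion (Chart.map (𝟙 X') (𝟙 S') (by simp) c.src c'.src
        (Chart.leU (leOfHom h).1) (Chart.leV (leOfHom h).1) ≫ tangentι c'.src) := by
      rw [map_tangentι (leOfHom h).1]; infer_instance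
    exact IsOpenImmersion.of_comp _ (tangentι c'.src)

end ChartPair

lemma tangentMap_aux {c c' : ChartPair (f' := f') (f := f) g s} (h : c ≤ c') :
    Chart.map (𝟙 X') (𝟙 S') (by simp) c.src c'.src (Chart.leU h.1) (Chart.leV h.1) ≫
      Chart.map g s sq c'.src c'.tgt c'.hU c'.hV ≫ tangentι c'.tgt =
      Chart.map g s sq c.src c.tgt c.hU c.hV ≫ tangentι c.tgt := by
  have hU : c.src.U ≤ g ⁻¹ᵁ c'.tgt.U := c.hU.trans (fun x hx ↦ h.2.1 hx)
  have hV : c.src.V ≤ s ⁻¹ᵁ c'.tgt.V := c.hV.trans (fun x hx ↦ h.2.2 hx)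
  rw [Chart.map_comp_assoc (𝟙 X') (𝟙 S') (by simp) g s sq c.src c'.src c'.tgt
    (Chart.leU h.1) (Chart.leV h.1) c'.hU c'.hV (h := g) (t := s) (by simp) (by simp) sq hU hV,
    ← map_tangentι h.2, Chart.map_comp_assoc g s sq (𝟙 X) (𝟙 S) (by simp) c.src c.tgt c'.tgt
    c.hU c.hV (Chart.leU h.2) (Chart.leV h.2) (h := g) (t := s) (by simp) (by simp) sq hU hV]

/-- A commutative square `(g, s)` from `X' ⟶ S'` to `X ⟶ S` induces the morphism
`T_{X'/S'} ⟶ T_{X/S}` which on compatible charts is given by `b ↦ g^♯ b`, `db ↦ d(g^♯ b)`. -/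
def tangentMap : tangent f' ⟶ tangent f :=
  (ChartPair.cover sq).glueMorphismsOfLocallyDirected
    (fun c ↦ Chart.map g s sq c.src c.tgt c.hU c.hV ≫ tangentι c.tgt)
    fun h ↦ tangentMap_aux g s sq (leOfHom h)

lemma tangentι_map (c' : Chart f') (c : Chart f) (hU : c'.U ≤ g ⁻¹ᵁ c.U)
    (hV : c'.V ≤ s ⁻¹ᵁ c.V) :
    tangentι c' ≫ tangentMap g s sq = Chart.map g s sq c' c hU hV ≫ tangentι c :=
  (ChartPair.cover sq).map_glueMorphismsOfLocallyDirected
    (fun c ↦ Chart.map g s sq c.src c.tgt c.hU c.hV ≫ tangentι c.tgt)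
    (fun h ↦ tangentMap_aux g s sq (leOfHom h))
    (⟨c', c, hU, hV⟩ : ChartPair (f' := f') (f := f) g s)

lemma tangentι_map_assoc (c' : Chart f') (c : Chart f) (hU : c'.U ≤ g ⁻¹ᵁ c.U)
    (hV : c'.V ≤ s ⁻¹ᵁ c.V) {Z : Scheme.{u}} (q : tangent f ⟶ Z) :
    tangentι c' ≫ tangentMap g s sq ≫ q = Chart.map g s sq c' c hU hV ≫ tangentι c ≫ q := by
  rw [← Category.assoc, tangentι_map g s sq c' c hU hV, Category.assoc]

lemma tangentMap_proj : tangentMap g s sq ≫ tangentProj f = tangentProj f' ≫ g := by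
  refine tangent_hom_ext fun x ↦ ?_
  obtain ⟨c, hc⟩ := ChartPair.exists_mem' sq x
  refine ⟨c.src, hc, ?_⟩
  rw [tangentι_map_assoc g s sq _ _ c.hU c.hV, tangentι_proj, ← Category.assoc, Chart.map_proj,
    Category.assoc, IsAffineOpen.SpecMap_appLE_fromSpec _ c.tgt.hU c.src.hU, ← Category.assoc,
    ← tangentι_proj, Category.assoc]

lemma tangentMap_proj_assoc {Z : Scheme.{u}} (q : X ⟶ Z) :
    tangentMap g s sq ≫ tangentProj f ≫ q = tangentProj f' ≫ g ≫ q := by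
  rw [← Category.assoc, tangentMap_proj, Category.assoc]

lemma tangentMap_id (sq) : tangentMap (f' := f) (f := f) (𝟙 X) (𝟙 S) sq = 𝟙 _ := by
  refine tangent_hom_ext fun x ↦ ?_
  obtain ⟨c, hc, -, -⟩ := Chart.exists_mem f x ⊤ trivial ⊤ trivial
  refine ⟨c, hc, ?_⟩
  rw [tangentι_map _ _ _ c c (Chart.leU le_rfl) (Chart.leV le_rfl), Chart.map_id]
  simp

lemma tangentMap_comp {X'' S'' : Scheme.{u}} {f'' : X'' ⟶ S''} (g' : X'' ⟶ X') (s' : S'' ⟶ S')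
    (sq' : f'' ≫ s' = g' ≫ f') {h : X'' ⟶ X} {t : S'' ⟶ S} (hh : h = g' ≫ g) (ht : t = s' ≫ s)
    (sq'' : f'' ≫ t = h ≫ f) :
    tangentMap g' s' sq' ≫ tangentMap g s sq = tangentMap h t sq'' := by
  subst hh ht
  refine tangent_hom_ext fun x ↦ ?_
  obtain ⟨c, hc⟩ := ChartPair.exists_mem' sq (g' x)
  obtain ⟨Z, hZ, -, -⟩ := Chart.exists_mem f'' x ⊤ trivial ⊤ trivial
  obtain ⟨d, hd, -, hdc⟩ := ChartPair.exists_mem sq' x Z hZ c.src hc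
  refine ⟨d.src, hd, ?_⟩
  have hU : d.tgt.U ≤ g ⁻¹ᵁ c.tgt.U := hdc.1.trans c.hU
  have hV : d.tgt.V ≤ s ⁻¹ᵁ c.tgt.V := hdc.2.trans c.hV
  have hU' : d.src.U ≤ (g' ≫ g) ⁻¹ᵁ c.tgt.U := fun y hy ↦ hU (d.hU hy)
  have hV' : d.src.V ≤ (s' ≫ s) ⁻¹ᵁ c.tgt.V := fun y hy ↦ hV (d.hV hy)
  rw [tangentι_map_assoc _ _ sq' _ _ d.hU d.hV, tangentι_map _ _ sq _ _ hU hV,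
    tangentι_map _ _ sq'' _ _ hU' hV',
    Chart.map_comp_assoc g' s' sq' g s sq _ _ _ _ _ _ _ rfl rfl sq'' hU' hV']

end map

/-- The relative tangent functor of `S`, sending `Z` over `S` to `T_{Z/S}`. -/
def tangentFunctor (S : Scheme.{u}) : Over S ⥤ Over S where
  obj Z := Over.mk (tangentProj Z.hom ≫ Z.hom)
  map {Z W} g := Over.homMk (tangentMap g.left (𝟙 S) (by simp)) (by
    simp [tangentMap_proj_assoc])
  map_id Z := by
    ext1
    exact tangentMap_id _
  map_comp {Z W V} g h := by
    ext1
    exact (tangentMap_comp _ _ _ _ _ _ (by simp) (by simp) _).symm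

section baseChange

variable {X Y : Scheme.{u}} (f : X ⟶ Y)

/-- The canonical base change morphism `T_{Z ×_Y X / X} ⟶ T_{Z/Y} ×_Y X`, for `h : Z ⟶ Y`: its
first component is induced by the projection `Z ×_Y X ⟶ Z` over `f : X ⟶ Y`. -/
def baseChangeLeft {Z : Scheme.{u}} (h : Z ⟶ Y) :
    tangent (pullback.snd h f) ⟶ pullback (tangentProj h ≫ h) f :=
  pullback.lift (tangentMap (pullback.fst h f) f pullback.condition.symm)
    (tangentProj (pullback.snd h f) ≫ pullback.snd h f)
    (by rw [tangentMap_proj_assoc, Category.assoc, pullback.condition])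

@[simp]
lemma baseChangeLeft_fst {Z : Scheme.{u}} (h : Z ⟶ Y) :
    baseChangeLeft f h ≫ pullback.fst _ _ =
      tangentMap (pullback.fst h f) f pullback.condition.symm :=
  pullback.lift_fst _ _ _

@[simp]
lemma baseChangeLeft_snd {Z : Scheme.{u}} (h : Z ⟶ Y) :
    baseChangeLeft f h ≫ pullback.snd _ _ =
      tangentProj (pullback.snd h f) ≫ pullback.snd h f :=
  pullback.lift_snd _ _ _

lemma baseChangeLeft_naturality {Z W : Scheme.{u}} (z : Z ⟶ Y) (w : W ⟶ Y) (h : Z ⟶ W)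
    (hw : h ≫ w = z) (k : pullback z f ⟶ pullback w f)
    (hk : k ≫ pullback.fst w f = pullback.fst z f ≫ h)
    (hk' : k ≫ pullback.snd w f = pullback.snd z f)
    (l : pullback (tangentProj z ≫ z) f ⟶ pullback (tangentProj w ≫ w) f) (sq)
    (hl : l ≫ pullback.fst _ _ = pullback.fst _ _ ≫ tangentMap (f' := z) (f := w) h (𝟙 Y) sq)
    (hl' : l ≫ pullback.snd _ _ = pullback.snd _ _) (sq') :
    tangentMap (f' := pullback.snd z f) (f := pullback.snd w f) k (𝟙 X) sq' ≫
      baseChangeLeft f w = baseChangeLeft f z ≫ l := by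
  refine pullback.hom_ext ?_ ?_
  · rw [Category.assoc, Category.assoc, baseChangeLeft_fst, hl, ← Category.assoc (baseChangeLeft f z), baseChangeLeft_fst]
    rw [tangentMap_comp (h := pullback.fst z f ≫ h) (t := f) _ _ _ _ _ _ hk.symm (by simp)
      (by rw [Category.assoc, hw, pullback.condition]),
      tangentMap_comp (h := pullback.fst z f ≫ h) (t := f) _ _ _ _ _ _ rfl (by simp)
      (by rw [Category.assoc, hw, pullback.condition])]
  · rw [Category.assoc, Category.assoc, baseChangeLeft_snd, hl', baseChangeLeft_snd,
      tangentMap_proj_assoc, hk']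

/-- The canonical base change transformation from `T_{∙/X} ∘ f^*` to `f^* ∘ T_{∙/Y}`, which at
`Z` over `Y` is the canonical morphism `T_{Z ×_Y X / X} ⟶ T_{Z/Y} ×_Y X`. -/
def baseChange : Over.pullback f ⋙ tangentFunctor X ⟶ tangentFunctor Y ⋙ Over.pullback f where
  app Z := Over.homMk (baseChangeLeft f Z.hom) (pullback.lift_snd _ _ _)
  naturality {Z W} h := by
    ext1
    exact baseChangeLeft_naturality f Z.hom W.hom h.left (Over.w h) _ (pullback.lift_fst _ _ _)
      (pullback.lift_snd _ _ _) _ _ (pullback.lift_fst _ _ _) (pullback.lift_snd _ _ _) _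

end baseChange

section pseudofunctor

/-- The unit isomorphism `Z ×_X X ≅ Z` of the pullback functors. -/
def pullbackUnit (X : Scheme.{u}) : Over.pullback (𝟙 X) ≅ 𝟭 (Over X) :=
  NatIso.ofComponents
    (fun Z ↦ Over.isoMk (asIso (pullback.fst Z.hom (𝟙 X)))
      (by simpa using pullback.condition (f := Z.hom) (g := 𝟙 X)))
    (fun {Z W} h ↦ by
      ext1
      exact pullback.lift_fst _ _ _)

@[simp]
lemma pullbackUnit_hom_app_left {X : Scheme.{u}} (Z : Over X) :
    ((pullbackUnit X).hom.app Z).left = pullback.fst Z.hom (𝟙 X) := rfl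

lemma compositor_naturality {X Y Z W W' : Scheme.{u}} (f : X ⟶ Y) (g : Y ⟶ Z) (w : W ⟶ Z)
    (w' : W' ⟶ Z) (h : W ⟶ W') (k : pullback (pullback.snd w g) f ⟶ pullback (pullback.snd w' g) f)
    (hk : k ≫ pullback.fst _ _ ≫ pullback.fst _ _ = pullback.fst _ _ ≫ pullback.fst _ _ ≫ h)
    (hk' : k ≫ pullback.snd _ _ = pullback.snd _ _)
    (l : pullback w (f ≫ g) ⟶ pullback w' (f ≫ g))
    (hl : l ≫ pullback.fst _ _ = pullback.fst _ _ ≫ h)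
    (hl' : l ≫ pullback.snd _ _ = pullback.snd _ _) :
    k ≫ (pullbackLeftPullbackSndIso w' g f).hom = (pullbackLeftPullbackSndIso w g f).hom ≫ l := by
  refine pullback.hom_ext ?_ ?_
  · simp [hk, hl]
  · simp [hk', hl']

/-- The compositor `f^*(g^* W) ≅ (g ∘ f)^* W` of the pullback functors, for `f : X ⟶ Y` and
`g : Y ⟶ Z`; it is the cancellation isomorphism `(W ×_Z Y) ×_Y X ≅ W ×_Z X`. -/
def compositor {X Y Z : Scheme.{u}} (f : X ⟶ Y) (g : Y ⟶ Z) :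
    Over.pullback g ⋙ Over.pullback f ≅ Over.pullback (f ≫ g) :=
  NatIso.ofComponents
    (fun W ↦ Over.isoMk (pullbackLeftPullbackSndIso W.hom g f)
      (pullbackLeftPullbackSndIso_hom_snd W.hom g f))
    (fun {W W'} h ↦ by
      ext1
      refine compositor_naturality f g W.hom W'.hom h.left _ ?_ (pullback.lift_snd _ _ _) _
        (pullback.lift_fst _ _ _) (pullback.lift_snd _ _ _)
      erw [pullback.lift_fst_assoc, Category.assoc, pullback.lift_fst]
      rfl)

@[simp]
lemma compositor_hom_app_left {X Y Z : Scheme.{u}} (f : X ⟶ Y) (g : Y ⟶ Z) (W : Over Z) :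
    ((compositor f g).hom.app W).left = (pullbackLeftPullbackSndIso W.hom g f).hom := rfl

@[simp]
lemma compositor_inv_app_left {X Y Z : Scheme.{u}} (f : X ⟶ Y) (g : Y ⟶ Z) (W : Over Z) :
    ((compositor f g).inv.app W).left = (pullbackLeftPullbackSndIso W.hom g f).inv := rfl

lemma eqToHom_pullback_left_fst {X Y : Scheme.{u}} {f f' : X ⟶ Y} (h : f = f')
    (hh : (Over.pullback f).toCatHom = (Over.pullback f').toCatHom) (W : Over Y) :
    ((eqToHom hh).toNatTrans.app W).left ≫ pullback.fst W.hom f' = pullback.fst W.hom f := by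
  subst h
  exact Category.id_comp _

lemma eqToHom_pullback_left_snd {X Y : Scheme.{u}} {f f' : X ⟶ Y} (h : f = f')
    (hh : (Over.pullback f).toCatHom = (Over.pullback f').toCatHom) (W : Over Y) :
    ((eqToHom hh).toNatTrans.app W).left ≫ pullback.snd W.hom f' = pullback.snd W.hom f := by
  subst h
  exact Category.id_comp _

lemma compositor_assoc {V W X Y Z : Scheme.{u}} (w : W ⟶ Z) (a : Y ⟶ Z) (b : X ⟶ Y) (c : V ⟶ X)
    (k : pullback (pullback.snd w (b ≫ a)) c ⟶ pullback (pullback.snd (pullback.snd w a) b) c)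
    (hk : k ≫ pullback.fst _ _ = pullback.fst _ _ ≫ (pullbackLeftPullbackSndIso w a b).inv)
    (hk' : k ≫ pullback.snd _ _ = pullback.snd _ _)
    (e : pullback w (c ≫ b ≫ a) ⟶ pullback w ((c ≫ b) ≫ a))
    (he : e ≫ pullback.fst _ _ = pullback.fst _ _)
    (he' : e ≫ pullback.snd _ _ = pullback.snd _ _) :
    (pullbackLeftPullbackSndIso w (b ≫ a) c).inv ≫ k ≫ 𝟙 _ ≫
      (pullbackLeftPullbackSndIso (pullback.snd w a) b c).hom ≫
        (pullbackLeftPullbackSndIso w a (c ≫ b)).hom = e := by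
  refine pullback.hom_ext ?_ ?_
  · simp [he, reassoc_of% hk]
  · simp [he', hk']

lemma pullbackUnit_left {W X Y : Scheme.{u}} (w : W ⟶ Y) (f : X ⟶ Y)
    (k : pullback (pullback.snd w (𝟙 Y)) f ⟶ pullback w f)
    (hk : k ≫ pullback.fst _ _ = pullback.fst _ _ ≫ pullback.fst _ _)
    (hk' : k ≫ pullback.snd _ _ = pullback.snd _ _)
    (e : pullback w (f ≫ 𝟙 Y) ⟶ pullback w f)
    (he : e ≫ pullback.fst _ _ = pullback.fst _ _)
    (he' : e ≫ pullback.snd _ _ = pullback.snd _ _) :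
    (pullbackLeftPullbackSndIso w (𝟙 Y) f).inv ≫ k ≫ 𝟙 _ = e := by
  refine pullback.hom_ext ?_ ?_
  · simp [he, hk]
  · simp [he', hk']

lemma pullbackUnit_right {W X Y : Scheme.{u}} (w : W ⟶ Y) (f : X ⟶ Y)
    (e : pullback w (𝟙 X ≫ f) ⟶ pullback w f)
    (he : e ≫ pullback.fst _ _ = pullback.fst _ _)
    (he' : e ≫ pullback.snd _ _ = pullback.snd _ _) :
    (pullbackLeftPullbackSndIso w f (𝟙 X)).inv ≫ pullback.fst _ _ ≫ 𝟙 _ = e := by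
  refine pullback.hom_ext ?_ ?_
  · simp [he]
  · simp only [he', Category.assoc, Category.id_comp]
    rw [pullbackLeftPullbackSndIso_inv_fst_snd, Category.comp_id]

/-- The pseudofunctor `Schᵒᵖ ⥤ Cat` with `X ↦ Sch/X` and `f ↦ f^*`, with the isomorphisms
`Z ×_X X ≅ Z` and `(W ×_Z Y) ×_Y X ≅ W ×_Z X` as its unitors and compositors. -/
def schOver : Pseudofunctor (LocallyDiscrete Scheme.{u}ᵒᵖ) Cat.{u, u + 1} :=
  LocallyDiscrete.mkPseudofunctor
    (fun X ↦ Cat.of (Over X.unop))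
    (fun f ↦ (Over.pullback f.unop).toCatHom)
    (fun X ↦ Cat.Hom.isoMk (pullbackUnit X.unop))
    (fun f g ↦ Cat.Hom.isoMk (compositor g.unop f.unop).symm)
    (fun f g h ↦ by
      ext W
      refine Over.OverMorphism.ext ?_
      exact compositor_assoc W.hom f.unop g.unop h.unop _ (pullback.lift_fst _ _ _)
        (pullback.lift_snd _ _ _) _
        (eqToHom_pullback_left_fst (by simp) _ W) (eqToHom_pullback_left_snd (by simp) _ W))
    (fun f ↦ by
      ext W
      refine Over.OverMorphism.ext ?_
      exact pullbackUnit_left W.hom f.unop _ (pullback.lift_fst _ _ _)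
        (pullback.lift_snd _ _ _) _
        (eqToHom_pullback_left_fst (by simp) _ W) (eqToHom_pullback_left_snd (by simp) _ W))
    (fun f ↦ by
      ext W
      refine Over.OverMorphism.ext ?_
      exact pullbackUnit_right W.hom f.unop _
        (eqToHom_pullback_left_fst (by simp) _ W) (eqToHom_pullback_left_snd (by simp) _ W))

/-- The components `app a` and the invertible cells `nat f` are those of a pseudonatural
transformation `F ⟹ G`. -/
def IsPseudonatural {B : Type*} [Bicategory B] {C : Type*} [Bicategory C] {F G : Pseudofunctor B C}
    (app : ∀ a : B, F.obj a ⟶ G.obj a)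
    (nat : ∀ (a b : B) (f : a ⟶ b), F.map f ≫ app b ≅ app a ≫ G.map f) : Prop :=
  ∃ σ : Pseudofunctor.StrongTrans F G,
    (⟨σ.app, fun _ _ f ↦ σ.naturality f⟩ : Σ' app : (∀ a : B, F.obj a ⟶ G.obj a),
      ∀ (a b : B) (f : a ⟶ b), F.map f ≫ app b ≅ app a ≫ G.map f) = ⟨app, nat⟩

end pseudofunctor

end RelTangent

end

/-!
A ring map `Sym_B(Ω¹_{B/A}) ⟶ R` is the same as a ring map `B ⟶ R[ε]` to the dual numbers whose
restriction to `A` has no `ε`-part. Hence a pushout square of rings `A ⟶ B`, `A' ⟶ B'` gives a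
pushout square `B ⟶ Sym_B(Ω¹_{B/A})`, `B' ⟶ Sym_{B'}(Ω¹_{B'/A'})`. For a cartesian square of
schemes with sides `X' ⟶ S'` and `X ⟶ S`, the scheme `X'` is covered by the affine opens
`U ×_V V'`, over each of which the square with sides `T_{X'/S'} ⟶ X'` and `T_{X/S} ⟶ X` is the
spectrum of such a pushout, so the latter square is cartesian. Pasting it with the original square
shows `T_{X'/S'} ≅ T_{X/S} ×_S S'`, which is the invertibility of `₍f₎T⁻¹`. Compatibility with
composition is checked on the two projections of the fibre product: on the first, both sides are
the map induced by one and the same square, and on the second both are the structure map.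
-/

noncomputable section

namespace RelTangent

section DualNumbers

variable {A B R : CommRingCat.{u}} {φ : A ⟶ B}

/-- The ring `R[ε]` of dual numbers as an object of `CommRingCat`. -/
abbrev dualNumbers (R : CommRingCat.{u}) : CommRingCat.{u} := .of (DualNumber R)

/-- The structure map `R ⟶ R[ε]`. -/
abbrev dualNumbersInl (R : CommRingCat.{u}) : R ⟶ dualNumbers R :=
  CommRingCat.ofHom (TrivSqZeroExt.inlHom R R)

/-- The augmentation `R[ε] ⟶ R`, `ε ↦ 0`. -/
abbrev dualNumbersFst (R : CommRingCat.{u}) : dualNumbers R ⟶ R :=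
  CommRingCat.ofHom (TrivSqZeroExt.fstHom R R R).toRingHom

lemma dualNumbers_hom_ext {q q' : B ⟶ dualNumbers R} (hfst : ∀ b, (q b).fst = (q' b).fst)
    (hsnd : ∀ b, (q b).snd = (q' b).snd) : q = q' :=
  CommRingCat.hom_ext (RingHom.ext fun b ↦ TrivSqZeroExt.ext (hfst b) (hsnd b))

/-- The ring map `B ⟶ R[ε]`, `b ↦ m b + ε m (db)`, attached to a ring map `m` out of
`Sym_B(Ω¹_{B/A})`. -/
def symToDualNumbers (m : symAlg φ ⟶ R) : B ⟶ dualNumbers R :=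
  CommRingCat.ofHom
    { toFun b := TrivSqZeroExt.inl (m (symIncl φ b)) + TrivSqZeroExt.inr (m (symD φ b))
      map_one' := by
        have : m (symD φ 1) = 0 := by simpa using congr(m $(symD_map φ 1))
        ext <;> simp [this]
      map_zero' := by
        have : m (symD φ 0) = 0 := by simpa using congr(m $(symD_map φ 0))
        ext <;> simp [this]
      map_add' b b' := by ext <;> simp [symD_add]
      map_mul' b b' := by ext <;> simp [symD_mul, mul_comm] }

lemma fst_symToDualNumbers (m : symAlg φ ⟶ R) (b : B) :
    (symToDualNumbers m b).fst = m (symIncl φ b) := by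
  simp [symToDualNumbers]

lemma snd_symToDualNumbers (m : symAlg φ ⟶ R) (b : B) :
    (symToDualNumbers m b).snd = m (symD φ b) := by
  simp [symToDualNumbers]

lemma snd_symToDualNumbers_map (m : symAlg φ ⟶ R) (a : A) :
    (symToDualNumbers m (φ a)).snd = 0 := by
  rw [snd_symToDualNumbers, symD_map, map_zero]

lemma symToDualNumbers_comp_fst (m : symAlg φ ⟶ R) :
    symToDualNumbers m ≫ dualNumbersFst R = symIncl φ ≫ m := by
  ext b
  exact fst_symToDualNumbers m b

lemma comp_symToDualNumbers (m : symAlg φ ⟶ R) :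
    φ ≫ symToDualNumbers m = (φ ≫ symIncl φ ≫ m) ≫ dualNumbersInl R :=
  dualNumbers_hom_ext (fun a ↦ fst_symToDualNumbers m (φ a)) (snd_symToDualNumbers_map m)

/-- Ring maps out of `Sym_B(Ω¹_{B/A})` are the ring maps `B ⟶ R[ε]` whose restriction to `A` has
no `ε`-part. -/
def symAlgHomEquiv (φ : A ⟶ B) (R : CommRingCat.{u}) :
    (symAlg φ ⟶ R) ≃ {q : B ⟶ dualNumbers R // ∀ a, (q (φ a)).snd = 0} where
  toFun m := ⟨symToDualNumbers m, snd_symToDualNumbers_map m⟩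
  invFun q := symDesc φ (q.1 ≫ dualNumbersFst R) (fun b ↦ (q.1 b).snd) (by simp)
    (by simp [mul_comm]) q.2
  left_inv m := symAlg_hom_ext (by rw [symIncl_desc, symToDualNumbers_comp_fst])
    fun b ↦ (symDesc_d ..).trans (snd_symToDualNumbers m b)
  right_inv q := Subtype.ext <| dualNumbers_hom_ext
    (fun b ↦ by rw [fst_symToDualNumbers, ← CommRingCat.comp_apply, symIncl_desc]; rfl)
    (fun b ↦ by rw [snd_symToDualNumbers, symDesc_d])

lemma symToDualNumbers_injective :
    Function.Injective (symToDualNumbers : (symAlg φ ⟶ R) → (B ⟶ dualNumbers R)) :=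
  Subtype.val_injective.comp (symAlgHomEquiv φ R).injective

variable {A' B' : CommRingCat.{u}} {φ' : A' ⟶ B'} {α : A ⟶ A'} {β : B ⟶ B'}

lemma symToDualNumbers_symMap_comp (h : φ ≫ β = α ≫ φ') (m : symAlg φ' ⟶ R) :
    symToDualNumbers (symMap α β h ≫ m) = β ≫ symToDualNumbers m := by
  refine dualNumbers_hom_ext (fun b ↦ ?_) fun b ↦ ?_
  · refine (fst_symToDualNumbers _ b).trans (.trans ?_ (fst_symToDualNumbers m (β b)).symm)
    exact congr(m $(ConcreteCategory.congr_hom (symIncl_map α β h) b))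
  · refine (snd_symToDualNumbers _ b).trans (.trans ?_ (snd_symToDualNumbers m (β b)).symm)
    exact congr(m $(symMap_d α β h b))

lemma exists_symMap_comp_eq (h : IsPushout φ α β φ') (p : B' ⟶ R) (n : symAlg φ ⟶ R)
    (hpn : β ≫ p = symIncl φ ≫ n) :
    ∃ m : symAlg φ' ⟶ R, symIncl φ' ≫ m = p ∧ symMap α β h.w ≫ m = n := by
  have hA : φ ≫ symToDualNumbers n = α ≫ (φ' ≫ p) ≫ dualNumbersInl R := by
    rw [comp_symToDualNumbers, ← hpn, reassoc_of% h.w, Category.assoc]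
  let q : B' ⟶ dualNumbers R := h.desc _ _ hA
  obtain ⟨m, hm⟩ : ∃ m : symAlg φ' ⟶ R, symToDualNumbers m = q := by
    have hq (a : A') : (q (φ' a)).snd = 0 :=
      congr(($(ConcreteCategory.congr_hom (h.inr_desc _ _ hA) a)).snd)
    exact ⟨(symAlgHomEquiv φ' R).symm ⟨q, hq⟩,
      congr($((symAlgHomEquiv φ' R).apply_symm_apply ⟨q, hq⟩).1)⟩
  refine ⟨m, ?_, symToDualNumbers_injective ?_⟩
  · rw [← symToDualNumbers_comp_fst, hm]
    refine h.hom_ext ?_ ?_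
    · rw [h.inl_desc_assoc, symToDualNumbers_comp_fst, hpn]
    · rw [h.inr_desc_assoc, Category.assoc]
      rfl
  · rw [symToDualNumbers_symMap_comp, hm, h.inl_desc]

lemma symAlg_hom_ext_of_isPushout (h : IsPushout φ α β φ') {m m' : symAlg φ' ⟶ R}
    (h₁ : symIncl φ' ≫ m = symIncl φ' ≫ m')
    (h₂ : symMap α β h.w ≫ m = symMap α β h.w ≫ m') : m = m' := by
  refine symToDualNumbers_injective (h.hom_ext ?_ ?_)
  · rw [← symToDualNumbers_symMap_comp h.w, h₂, symToDualNumbers_symMap_comp h.w]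
  · rw [comp_symToDualNumbers, h₁, comp_symToDualNumbers]

lemma isPushout_symMap_of_isPushout (h : IsPushout φ α β φ') :
    IsPushout β (symIncl φ) (symIncl φ') (symMap α β h.w) := by
  choose m hm using fun s : PushoutCocone β (symIncl φ) ↦
    exists_symMap_comp_eq h s.inl s.inr s.condition
  exact ⟨⟨by simp⟩, ⟨PushoutCocone.IsColimit.mk _ m (fun s ↦ (hm s).1) (fun s ↦ (hm s).2)
    fun s m' h₁ h₂ ↦ symAlg_hom_ext_of_isPushout h (h₁.trans (hm s).1.symm)
      (h₂.trans (hm s).2.symm)⟩⟩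

end DualNumbers

section CartesianSquare

lemma isPullback_of_openCover_of_isPullback {W X Y Z : Scheme.{u}} {fWX : W ⟶ X} {fWY : W ⟶ Y}
    {fXZ : X ⟶ Z} {fYZ : Y ⟶ Z} (𝒰 : X.OpenCover) {P : 𝒰.I₀ → Scheme.{u}}
    {p : ∀ i, P i ⟶ 𝒰.X i} {j : ∀ i, P i ⟶ W}
    (hWX : ∀ i, IsPullback (p i) (j i) (𝒰.f i) fWX)
    (hYZ : ∀ i, IsPullback (p i) (j i ≫ fWY) (𝒰.f i ≫ fXZ) fYZ) :
    IsPullback fWX fWY fXZ fYZ := by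
  refine Scheme.isPullback_of_openCover _ _ _ _ 𝒰 fun i ↦ ?_
  have h := (hWX i).flip
  refine (hYZ i).of_iso h.isoPullback (.refl _) (.refl _) (.refl _) ?_ ?_ (by simp) (by simp)
  · exact (Category.comp_id _).trans h.isoPullback_hom_snd.symm
  · exact (Category.comp_id _).trans (h.isoPullback_hom_fst_assoc fWY).symm

variable {X' S' X S : Scheme.{u}} {f' : X' ⟶ S'} {f : X ⟶ S} {g : X' ⟶ X} {s : S' ⟶ S}

lemma isAffineOpen_inf_of_isPullback (h : IsPullback g f' f s) {U : X.Opens} {V : S.Opens}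
    {V' : S'.Opens} (hU : IsAffineOpen U) (hV : IsAffineOpen V) (hV' : IsAffineOpen V')
    (hUV : U ≤ f ⁻¹ᵁ V) (hV'V : V' ≤ s ⁻¹ᵁ V) : IsAffineOpen (g ⁻¹ᵁ U ⊓ f' ⁻¹ᵁ V') := by
  have : IsAffine U := hU
  have : IsAffine V := hV
  have : IsAffine V' := hV'
  exact .of_isIso (Scheme.Hom.isPullback_resLE h hV'V hUV rfl).isoPullback.hom

namespace ChartPair

/-- A pair of charts `U' ⟶ V'` of `f'` and `U ⟶ V` of `f` is cartesian if `U'` is the part of `X'`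
lying over both `U` and `V'`; if the square formed by `f'` and `f` is cartesian, this says that
`U' = U ×_V V'`. -/
def IsCartesian (c : ChartPair (f' := f') (f := f) g s) : Prop :=
  c.src.U = g ⁻¹ᵁ c.tgt.U ⊓ f' ⁻¹ᵁ c.src.V

lemma exists_isCartesian_mem (h : IsPullback g f' f s) (x : X') :
    ∃ c : ChartPair (f' := f') (f := f) g s, c.IsCartesian ∧ x ∈ c.src.U := by
  obtain ⟨c, hxc, -, -⟩ := Chart.exists_mem f (g x) ⊤ trivial ⊤ trivial
  have hx : f' x ∈ s ⁻¹ᵁ c.V := by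
    change s (f' x) ∈ c.V
    rw [← Scheme.Hom.comp_apply, ← h.w, Scheme.Hom.comp_apply]
    exact c.le hxc
  obtain ⟨_, ⟨V', hV', rfl⟩, hxV', hV'V⟩ :=
    S'.isBasis_affineOpens.exists_subset_of_mem_open hx (s ⁻¹ᵁ c.V).2
  let c' : Chart f' := ⟨g ⁻¹ᵁ c.U ⊓ f' ⁻¹ᵁ V', V',
    isAffineOpen_inf_of_isPullback h c.hU c.hV hV' c.le hV'V, hV', inf_le_right⟩
  exact ⟨⟨c', c, inf_le_left, hV'V⟩, rfl, hxc, hxV'⟩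

/-- The cover of `X'` by the sources of the cartesian pairs of charts of a cartesian square. -/
abbrev cartesianCover (h : IsPullback g f' f s) : X'.OpenCover where
  I₀ := { c : ChartPair (f' := f') (f := f) g s // c.IsCartesian }
  X c := Spec Γ(X', c.1.src.U)
  f c := c.1.src.hU.fromSpec
  mem₀ := by
    rw [Scheme.presieve₀_mem_precoverage_iff]
    refine ⟨fun x ↦ ?_, fun c ↦ c.1.src.hU.isOpenImmersion_fromSpec⟩
    obtain ⟨c, hc, hxc⟩ := exists_isCartesian_mem h x
    refine ⟨⟨c, hc⟩, ?_⟩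
    rwa [c.src.hU.range_fromSpec]

lemma IsCartesian.isPushout_appLE {c : ChartPair (f' := f') (f := f) g s} (hc : c.IsCartesian)
    (h : IsPullback g f' f s) :
    IsPushout c.tgt.ring (s.appLE c.tgt.V c.src.V c.hV) (g.appLE c.tgt.U c.src.U c.hU)
      c.src.ring :=
  (isIso_pushoutSection_iff ..).mp
    (isIso_pushoutSection_of_isAffineOpen h c.hV c.tgt.le hc c.tgt.hV c.src.hV c.tgt.hU)

lemma IsCartesian.isPullback_map {c : ChartPair (f' := f') (f := f) g s} (hc : c.IsCartesian)
    (h : IsPullback g f' f s) :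
    IsPullback c.src.proj (Chart.map g s h.w.symm c.src c.tgt c.hU c.hV)
      (Spec.map (g.appLE c.tgt.U c.src.U c.hU)) c.tgt.proj :=
  isPullback_SpecMap_of_isPushout _ _ _ _
    (isPushout_symMap_of_isPushout (hc.isPushout_appLE h))

end ChartPair

lemma isPullback_tangentMap (h : IsPullback g f' f s) :
    IsPullback (tangentProj f') (tangentMap g s h.w.symm) g (tangentProj f) := by
  refine isPullback_of_openCover_of_isPullback (ChartPair.cartesianCover h)
    (fun c ↦ isPullback_tangentι c.1.src) fun ⟨c, hc⟩ ↦ ?_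
  rw [tangentι_map g s h.w.symm c.src c.tgt c.hU c.hV]
  have hg := IsAffineOpen.SpecMap_appLE_fromSpec g c.tgt.hU c.src.hU c.hU
  exact hg ▸ (hc.isPullback_map h).paste_vert (isPullback_tangentι c.tgt)

end CartesianSquare

section BaseChange

lemma tangentMap_comp_tangentMap {X'' S'' X' S' X S : Scheme.{u}} {f'' : X'' ⟶ S''}
    {f' : X' ⟶ S'} {f : X ⟶ S} {g' : X'' ⟶ X'} {s' : S'' ⟶ S'} {g : X' ⟶ X} {s : S' ⟶ S}
    (sq' : f'' ≫ s' = g' ≫ f') (sq : f' ≫ s = g ≫ f) :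
    tangentMap g' s' sq' ≫ tangentMap g s sq =
      tangentMap (g' ≫ g) (s' ≫ s) (by rw [reassoc_of% sq', sq, Category.assoc]) :=
  tangentMap_comp _ _ _ _ _ _ rfl rfl _

variable {X Y Z : Scheme.{u}} (f : X ⟶ Y) (g : Y ⟶ Z)

instance isIso_baseChangeLeft {W : Scheme.{u}} (w : W ⟶ Y) : IsIso (baseChangeLeft f w) := by
  have h := IsPullback.of_hasPullback w f
  have e : baseChangeLeft f w = ((isPullback_tangentMap h).flip.paste_vert h).isoPullback.hom := by
    refine pullback.hom_ext ?_ ?_ <;> simp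
  rw [e]
  infer_instance

instance isIso_baseChange : IsIso (baseChange f) := by
  have (W : Over Y) : IsIso ((baseChange f).app W) :=
    have : IsIso ((Over.forget X).map ((baseChange f).app W)) := isIso_baseChangeLeft f W.hom
    isIso_of_reflects_iso _ (Over.forget X)
  exact NatIso.isIso_of_isIso_app _

/-- The natural isomorphism `₍f₎T : f^* ∘ T_{∙/Y} ≅ T_{∙/X} ∘ f^*`, inverse to the canonical base
change transformation. -/
def baseChangeIso : tangentFunctor Y ⋙ Over.pullback f ≅ Over.pullback f ⋙ tangentFunctor X :=
  (asIso (baseChange f)).symm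

lemma baseChangeLeft_compositor {W : Scheme.{u}} (w : W ⟶ Z) :
    baseChangeLeft f (pullback.snd w g) ≫
        pullback.lift (pullback.fst _ _ ≫ baseChangeLeft g w) (pullback.snd _ _)
          (by rw [Category.assoc, baseChangeLeft_snd, pullback.condition]) ≫
        (pullbackLeftPullbackSndIso (tangentProj w ≫ w) g f).hom =
      tangentMap (f' := pullback.snd (pullback.snd w g) f) (f := pullback.snd w (f ≫ g))
        (pullbackLeftPullbackSndIso w g f).hom (𝟙 X) (by simp) ≫ baseChangeLeft (f ≫ g) w := by
  refine pullback.hom_ext ?_ ?_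
  · simp only [Category.assoc, pullbackLeftPullbackSndIso_hom_fst, baseChangeLeft_fst]
    rw [pullback.lift_fst_assoc, Category.assoc, baseChangeLeft_fst,
      reassoc_of% (baseChangeLeft_fst f)]
    simp [tangentMap_comp_tangentMap]
  · simp only [Category.assoc, pullbackLeftPullbackSndIso_hom_snd, baseChangeLeft_snd,
      tangentMap_proj_assoc]
    rw [pullback.lift_snd, baseChangeLeft_snd]

lemma baseChange_compositor :
    (Functor.associator (Over.pullback g) (Over.pullback f) (tangentFunctor X)).hom ≫
        Functor.whiskerLeft (Over.pullback g) (baseChange f) ≫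
        (Functor.associator (Over.pullback g) (tangentFunctor Y) (Over.pullback f)).inv ≫
        Functor.whiskerRight (baseChange g) (Over.pullback f) ≫
        (Functor.associator (tangentFunctor Z) (Over.pullback g) (Over.pullback f)).hom ≫
        Functor.whiskerLeft (tangentFunctor Z) (compositor f g).hom =
      Functor.whiskerRight (compositor f g).hom (tangentFunctor X) ≫ baseChange (f ≫ g) := by
  ext W : 3
  simp only [NatTrans.comp_app, Functor.associator_hom_app, Functor.whiskerLeft_app,
    Functor.associator_inv_app, Functor.whiskerRight_app, Functor.comp_obj, Category.id_comp,
    Over.comp_left]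
  exact baseChangeLeft_compositor f g W.hom

lemma baseChange_compositor_inv :
    baseChange (f ≫ g) ≫ Functor.whiskerLeft (tangentFunctor Z) (compositor f g).inv =
      Functor.whiskerRight (compositor f g).inv (tangentFunctor X) ≫
        (Functor.associator (Over.pullback g) (Over.pullback f) (tangentFunctor X)).hom ≫
        Functor.whiskerLeft (Over.pullback g) (baseChange f) ≫
        (Functor.associator (Over.pullback g) (tangentFunctor Y) (Over.pullback f)).inv ≫
        Functor.whiskerRight (baseChange g) (Over.pullback f) ≫
        (Functor.associator (tangentFunctor Z) (Over.pullback g) (Over.pullback f)).hom := by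
  rw [← Functor.isoWhiskerLeft_inv, Iso.comp_inv_eq, ← Functor.isoWhiskerRight_inv, Category.assoc,
    Iso.eq_inv_comp]
  simpa using (baseChange_compositor f g).symm

lemma baseChange_pullbackUnit (X : Scheme.{u}) :
    baseChange (𝟙 X) ≫ Functor.whiskerLeft (tangentFunctor X) (pullbackUnit X).hom =
      Functor.whiskerRight (pullbackUnit X).hom (tangentFunctor X) ≫
        (Functor.leftUnitor _).hom ≫ (Functor.rightUnitor _).inv := by
  ext W : 3
  simp only [NatTrans.comp_app, Functor.whiskerLeft_app, Functor.whiskerRight_app,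
    Functor.leftUnitor_hom_app, Functor.rightUnitor_inv_app, Functor.comp_obj, Functor.id_obj,
    Category.comp_id, Over.comp_left]
  exact baseChangeLeft_fst (𝟙 X) W.hom

open Bicategory in
lemma naturality_naturality_of_locallyDiscrete {C : Type*} [Category* C] {B : Type*} [Bicategory B]
    {F G : Pseudofunctor (LocallyDiscrete C) B} (app : ∀ a, F.obj a ⟶ G.obj a)
    (naturality : ∀ {a b} (f : a ⟶ b), F.map f ≫ app b ≅ app a ≫ G.map f)
    {a b : LocallyDiscrete C} {f g : a ⟶ b} (η : f ⟶ g) :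
    F.map₂ η ▷ app b ≫ (naturality g).hom = (naturality f).hom ≫ app a ◁ G.map₂ η := by
  obtain rfl : f = g := Discrete.ext (Discrete.eq_of_hom η)
  obtain rfl : η = 𝟙 f := Subsingleton.elim _ _
  simp

/-- The pseudonatural transformation with components the relative tangent functors and with the
canonical base change transformations as structure cells. -/
def tangentTrans : Pseudofunctor.StrongTrans schOver.{u} schOver.{u} where
  app X := (tangentFunctor X.as.unop).toCatHom
  naturality f := Cat.Hom.isoMk (baseChangeIso f.as.unop).symm
  naturality_naturality := naturality_naturality_of_locallyDiscrete (F := schOver) (G := schOver)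
    (fun X ↦ (tangentFunctor X.as.unop).toCatHom)
    (fun f ↦ Cat.Hom.isoMk (baseChangeIso f.as.unop).symm)
  naturality_id X := congrArg NatTrans.toCatHom₂ (baseChange_pullbackUnit X.as.unop)
  naturality_comp f g :=
    congrArg NatTrans.toCatHom₂ (baseChange_compositor_inv g.as.unop f.as.unop)

end BaseChange

end RelTangent

end

theorem mainTheorem8 :
    ∃ T : ∀ {X Y : Scheme.{u}} (f : X ⟶ Y),
        RelTangent.tangentFunctor Y ⋙ Over.pullback f ≅
          Over.pullback f ⋙ RelTangent.tangentFunctor X,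
      (∀ {X Y : Scheme.{u}} (f : X ⟶ Y), (T f).inv = RelTangent.baseChange f) ∧
      (∀ {X Y Z : Scheme.{u}} (f : X ⟶ Y) (g : Y ⟶ Z),
        (Functor.associator (Over.pullback g) (Over.pullback f)
              (RelTangent.tangentFunctor X)).hom ≫
            Functor.whiskerLeft (Over.pullback g) (T f).inv ≫
            (Functor.associator (Over.pullback g) (RelTangent.tangentFunctor Y)
              (Over.pullback f)).inv ≫
            Functor.whiskerRight (T g).inv (Over.pullback f) ≫
            (Functor.associator (RelTangent.tangentFunctor Z) (Over.pullback g)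
              (Over.pullback f)).hom ≫
            Functor.whiskerLeft (RelTangent.tangentFunctor Z) (RelTangent.compositor f g).hom =
          Functor.whiskerRight (RelTangent.compositor f g).hom (RelTangent.tangentFunctor X) ≫
            (T (f ≫ g)).inv) ∧
      RelTangent.IsPseudonatural (F := RelTangent.schOver.{u}) (G := RelTangent.schOver.{u})
        (fun X ↦ (RelTangent.tangentFunctor X.as.unop).toCatHom)
        (fun X Y f ↦ Cat.Hom.isoMk (T f.as.unop).symm) :=
  ⟨RelTangent.baseChangeIso, fun _ ↦ rfl, RelTangent.baseChange_compositor,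
    RelTangent.tangentTrans, rfl⟩
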